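/- Consider the semilinear Dirichlet problem $-\Delta u + b(x,u) = 0$ in $\Omega\subset\mathbb R^d$, $u=0$ on $\partial\Omega$, for $d=1,2$. Here $b(x,\eta)$ is measurable in $x\in\Omega$ for each $\eta\in\mathbb R$ and $C^1$ in $\eta$ for a.e. $x\in\Omega$, and there is a constant $B_\eta\ge 0$ such that $0\le \frac{\partial b}{\partial\eta}(x,\eta)\le B_\eta$ for a.e. $x\in\Omega$ and all $\eta\in\mathbb R$. For $d=1$ let $\Omega=(\alpha,\beta)$ with a subdivision $\alpha=a_0<a_1<\dots<a_n=\beta$, $n\ge 1$, and put $h_k=a_k-a_{k-1}$ and $\mathcal T=\{[a_{k-1},a_k] : 1\le k\le n\}$. For $d=2$ let $\Omega$ be a bounded open set with a finite conforming triangulation $\mathcal T$: the closed triangles of $\mathcal T$ cover exactly $\overline\Omega$, any two of them are disjoint or meet in a common vertex, edge or triangle, and $\partial\Omega$ is a union of edges of $\mathcal T$. Suppose for $d=2$ that there are $0<t_{\min}\le t_{\max}<\pi/2$ such that all interior angles $\theta_{T,1},\theta_{T,2},\theta_{T,3}$ of all $T\in\mathcal T$ lie in $[t_{\min},t_{\max}]$;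 $|T|$ denotes the area of $T$. Let $\mathcal V$ be the space of continuous functions on $\overline\Omega$ that vanish on $\partial\Omega$ and are affine on each $T\in\mathcal T$. Let $u_1\in\mathcal V$ be a discrete subsolution and $u_2\in\mathcal V$ a discrete supersolution, i.e., for all $v\in\mathcal V$ with $v\ge0$, the functions $b(\cdot,u_1)v$ and $b(\cdot,u_2)v$ are integrable on $\Omega$ and $$\int_\Omega \nabla u_1\cdot\nabla v+b(x,u_1)\,v\,dx\le 0,\qquad \int_\Omega \nabla u_2\cdot\nabla v+b(x,u_2)\,v\,dx\ge 0 .$$ Assume $$h_k^2<\frac{2}{B_\eta},\quad k=1,\dots,n,\qquad\text{if } d=1,$$ $$|T|<\frac{3}{7B_\eta}\,\min_{k=1,2,3}\cot\theta_{T,k}\quad\text{for each }T\in\mathcal T,\qquad\text{if } d=2,$$ where these conditions are void if $B_\eta=0$. Then $u_1\le u_2$ in $\Omega$. -/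

import Mathlib

open Set MeasureTheory

namespace SemilinearFEM

section General

variable {E : Type*} [NormedAddCommGroup E] [InnerProductSpace ℝ E]

/-- The continuous piecewise linear (P1) finite element space on the cells `cells` of a mesh of
`Ω`, with homogeneous Dirichlet condition on `∂Ω`.  Its elements are identified with their
extension by zero to the whole space: a continuous function on the closure of `Ω` that vanishes on
`∂Ω` is the same thing as a continuous function on `E` that vanishes outside `Ω`. -/
def P1Space (Ω : Set E) (cells : Set (Set E)) : Set (E → ℝ) :=
  {u | Continuous u ∧ (∀ x, x ∉ Ω → u x = 0) ∧
    ∀ T ∈ cells, ∃ f : E →ᵃ[ℝ] ℝ, Set.EqOn u f T}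

/-- The nonlinearity `b` is a Carathéodory function on `Ω × ℝ`: (Lebesgue) measurable in `x` for
each `η`, and `C¹` in `η` for a.e. `x`; and `0 ≤ ∂b/∂η ≤ B` for a.e. `x ∈ Ω` and all `η`
(in particular `b x` is nondecreasing for a.e. `x`). -/
structure IsAdmissible [MeasureSpace E] (Ω : Set E) (b : E → ℝ → ℝ) (B : ℝ) : Prop where
  nonneg : 0 ≤ B
  measurable : ∀ η : ℝ, AEMeasurable (fun x => b x η) (volume.restrict Ω)
  contDiff : ∀ᵐ x ∂(volume.restrict Ω), ContDiff ℝ 1 (b x)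
  deriv_bound : ∀ᵐ x ∂(volume.restrict Ω), ∀ η : ℝ, 0 ≤ deriv (b x) η ∧ deriv (b x) η ≤ B

/-- The weak form `∫_Ω ∇u · ∇v + b(x,u) v dx`.  For `u`, `v` in a P1 space on a mesh of `Ω` the
gradients exist and are constant in the interior of each cell, hence are defined a.e. in `Ω`. -/
noncomputable def weakForm [CompleteSpace E] [MeasureSpace E] (Ω : Set E) (b : E → ℝ → ℝ)
    (u v : E → ℝ) : ℝ :=
  ∫ x in Ω, (inner ℝ (gradient u x) (gradient v x) + b x (u x) * v x)

/-- `u` is a discrete subsolution: `u` is in the P1 space, and for every nonnegative `v` in the P1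
space the weak form makes sense as an integral and is `≤ 0`. -/
def IsSubsolution [CompleteSpace E] [MeasureSpace E] (Ω : Set E) (cells : Set (Set E))
    (b : E → ℝ → ℝ) (u : E → ℝ) : Prop :=
  u ∈ P1Space Ω cells ∧ ∀ v ∈ P1Space Ω cells, (∀ x, 0 ≤ v x) →
    IntegrableOn (fun x => b x (u x) * v x) Ω ∧ weakForm Ω b u v ≤ 0

/-- `u` is a discrete supersolution: `u` is in the P1 space, and for every nonnegative `v` in the
P1 space the weak form makes sense as an integral and is `≥ 0`. -/
def IsSupersolution [CompleteSpace E] [MeasureSpace E] (Ω : Set E) (cells : Set (Set E))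
    (b : E → ℝ → ℝ) (u : E → ℝ) : Prop :=
  u ∈ P1Space Ω cells ∧ ∀ v ∈ P1Space Ω cells, (∀ x, 0 ≤ v x) →
    IntegrableOn (fun x => b x (u x) * v x) Ω ∧ 0 ≤ weakForm Ω b u v

end General

section OneDim

/-- The interval `(a₀, aₙ)` subdivided by the nodes `a₀ < a₁ < ... < aₙ`. -/
def interval {n : ℕ} (a : Fin (n + 1) → ℝ) : Set ℝ := Set.Ioo (a 0) (a (Fin.last n))

/-- The cells `[a_{k-1}, a_k]`, `k = 1, ..., n`. -/
def intervalCells {n : ℕ} (a : Fin (n + 1) → ℝ) : Set (Set ℝ) :=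
  Set.range fun k : Fin n => Set.Icc (a k.castSucc) (a k.succ)

end OneDim

section TwoDim

/-- The plane with its Euclidean norm and Lebesgue measure. -/
abbrev Plane : Type := EuclideanSpace ℝ (Fin 2)

/-- `K` is a (finite, conforming) triangulation of the open set `Ω`, which exactly captures the
boundary: the triangles of `K` cover the closure of `Ω`, any two faces meet in a common face or
not at all (this is part of `Geometry.SimplicialComplex`), every vertex and edge belongs to a
triangle, and `∂Ω` is a union of edges. -/
structure IsTriangulation (K : Geometry.SimplicialComplex ℝ Plane) (Ω : Set Plane) : Prop where
  isOpen : IsOpen Ω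
  finite : K.faces.Finite
  pure : ∀ s ∈ K.faces, ∃ t ∈ K.faces, s ⊆ t ∧ t.card = 3
  space_eq : K.space = closure Ω
  frontier_eq : ∃ edges ⊆ K.faces, (∀ e ∈ edges, e.card = 2) ∧
    frontier Ω = ⋃ e ∈ edges, convexHull ℝ (e : Set Plane)

/-- The vertex sets of the triangles of `K`. -/
def triangles (K : Geometry.SimplicialComplex ℝ Plane) : Set (Finset Plane) :=
  {t | t ∈ K.faces ∧ t.card = 3}

/-- The closed triangles of `K`, as subsets of the plane. -/
def triangleCells (K : Geometry.SimplicialComplex ℝ Plane) : Set (Set Plane) :=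
  (fun t : Finset Plane => convexHull ℝ (t : Set Plane)) '' triangles K

/-- The set of the three interior angles of the triangle with vertex set `t`. -/
noncomputable def interiorAngles (t : Finset Plane) : Set ℝ :=
  {θ | ∃ p ∈ t, ∃ q ∈ t, ∃ r ∈ t, p ≠ q ∧ q ≠ r ∧ p ≠ r ∧ θ = EuclideanGeometry.angle p q r}

/-- The area of the triangle with vertex set `t`. -/
noncomputable def area (t : Finset Plane) : ℝ :=
  (volume (convexHull ℝ (t : Set Plane))).toReal

/-- Mesh regularity: all interior angles of all triangles lie in `[tmin, tmax]`, where
`0 < tmin ≤ tmax < π/2`. -/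
structure IsRegularMesh (K : Geometry.SimplicialComplex ℝ Plane) (tmin tmax : ℝ) : Prop where
  pos : 0 < tmin
  le : tmin ≤ tmax
  lt : tmax < Real.pi / 2
  angles : ∀ t ∈ triangles K, ∀ θ ∈ interiorAngles t, tmin ≤ θ ∧ θ ≤ tmax

end TwoDim

end SemilinearFEM

/-!
Test both inequalities with the nodal interpolant `v` of the positive part of `w = u₁ - u₂`. On a
cell, the difference of the two weak integrands is `∇w · ∇v + c w v` with `0 ≤ c ≤ B`, as `b` is
nondecreasing and `B`-Lipschitz in `η`. Expanding in barycentric coordinates, `w - v` and `v` have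
nodal values of opposite sign and disjoint support, so `∇(w - v) · ∇v + c (w - v) v` only contains
products of distinct coordinates; as `λᵢ λⱼ ≤ 1 / 4`, it is nonnegative as soon as
`∇λᵢ · ∇λⱼ ≤ -B / 4`. This pointwise acuteness is what the mesh conditions provide: `∇λᵢ · ∇λⱼ` is
`-1 / h²` on an interval of length `h` and `-cot θ / (2 |T|)` on a triangle `T` with the angle `θ`
at the third vertex. Hence `∫ |∇v|² ≤ 0`, so `v = 0`, and `w ≤ 0` at the nodes.
-/

namespace SemilinearFEM

section AffineGradient

variable {E : Type*} [NormedAddCommGroup E] [InnerProductSpace ℝ E] [FiniteDimensional ℝ E]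

/-- The constant gradient of an affine function, as a linear map. -/
noncomputable def affineGradient : (E →ᵃ[ℝ] ℝ) →ₗ[ℝ] E where
  toFun f := (InnerProductSpace.toDual ℝ E).symm (LinearMap.toContinuousLinearMap f.linear)
  map_add' f g := by simp
  map_smul' c f := by simp

theorem inner_affineGradient (f : E →ᵃ[ℝ] ℝ) (x : E) :
    inner ℝ (affineGradient f) x = f.linear x := by
  simp [affineGradient]

theorem inner_affineGradient_sub (f : E →ᵃ[ℝ] ℝ) (x y : E) :
    inner ℝ (affineGradient f) (x - y) = f x - f y := by
  simpa using (inner_affineGradient f (x - y)).trans (f.linearMap_vsub x y)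

theorem eq_of_affineGradient_eq_zero {f : E →ᵃ[ℝ] ℝ} (hf : affineGradient f = 0) (x y : E) :
    f x = f y := by
  rw [← sub_eq_zero, ← inner_affineGradient_sub, hf, inner_zero_left]

theorem hasGradientAt_affineMap (f : E →ᵃ[ℝ] ℝ) (x : E) :
    HasGradientAt f (affineGradient f) x := by
  rw [hasGradientAt_iff_hasFDerivAt, f.decomp]
  simpa [affineGradient, Pi.add_def] using
    (LinearMap.toContinuousLinearMap f.linear).hasFDerivAt.add_const (f 0)

theorem gradient_eq_affineGradient {u : E → ℝ} {f : E →ᵃ[ℝ] ℝ} {T : Set E} (hu : EqOn u f T)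
    {x : E} (hx : x ∈ interior T) : gradient u x = affineGradient f :=
  ((hasGradientAt_affineMap f x).congr_of_eventuallyEq
    (hu.eventuallyEq_of_mem (mem_interior_iff_mem_nhds.1 hx))).gradient

end AffineGradient

section Simplex

variable {ι E : Type*} [NormedAddCommGroup E] [InnerProductSpace ℝ E]

theorem affineMap_eqOn_convexHull {f g : E →ᵃ[ℝ] ℝ} {s : Set E} (h : EqOn f g s) :
    EqOn f g (convexHull ℝ s) := fun _ hx =>
  AffineMap.eqOn_affineSpan h (convexHull_subset_affineSpan s hx)

theorem affineMap_nonneg_on_convexHull {f : E →ᵃ[ℝ] ℝ} {s : Set E} (h : ∀ x ∈ s, 0 ≤ f x) :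
    ∀ x ∈ convexHull ℝ s, 0 ≤ f x :=
  convexHull_min (t := f ⁻¹' Ici 0) h ((convex_Ici 0).affine_preimage f)

/-- The affine function with the same values as `N` at the vertices of the simplex `b`. -/
noncomputable def nodalInterpolant [Fintype ι] (b : AffineBasis ι ℝ E) (N : E → ℝ) : E →ᵃ[ℝ] ℝ :=
  ∑ i, N (b i) • b.coord i

theorem nodalInterpolant_apply [Fintype ι] (b : AffineBasis ι ℝ E) (N : E → ℝ) (x : E) :
    nodalInterpolant b N x = ∑ i, N (b i) * b.coord i x :=
  map_sum (⟨⟨fun f => f x, rfl⟩, fun _ _ => rfl⟩ : (E →ᵃ[ℝ] ℝ) →+ ℝ) _ _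

theorem nodalInterpolant_vertex [Fintype ι] (b : AffineBasis ι ℝ E) (N : E → ℝ) (i : ι) :
    nodalInterpolant b N (b i) = N (b i) := by
  classical
  simp [nodalInterpolant_apply, AffineBasis.coord_apply]

theorem nodalInterpolant_affineMap [Fintype ι] (b : AffineBasis ι ℝ E) (f : E →ᵃ[ℝ] ℝ) :
    nodalInterpolant b f = f :=
  AffineMap.ext_on b.tot (forall_mem_range.2 (nodalInterpolant_vertex b f))

theorem mul_eq_sum_coord_mul_coord [Fintype ι] (b : AffineBasis ι ℝ E) (f g : E →ᵃ[ℝ] ℝ) (x : E) :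
    f x * g x = ∑ i, ∑ j, f (b i) * g (b j) * (b.coord i x * b.coord j x) := by
  conv_lhs => rw [← nodalInterpolant_affineMap b f, ← nodalInterpolant_affineMap b g]
  simp only [nodalInterpolant_apply, Finset.sum_mul_sum, mul_mul_mul_comm]

theorem coord_mul_coord_le_one_div_four [Finite ι] {b : AffineBasis ι ℝ E} {i j : ι} (hij : i ≠ j)
    {x : E} (hx : x ∈ convexHull ℝ (range b)) : b.coord i x * b.coord j x ≤ 1 / 4 := by
  classical
  cases nonempty_fintype ι
  rw [b.convexHull_eq_nonneg_coord] at hx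
  have hsum : b.coord i x + b.coord j x ≤ 1 := by
    rw [← b.sum_coord_apply_eq_one x, ← Finset.sum_pair (f := fun k => b.coord k x) hij]
    exact Finset.sum_le_univ_sum_of_nonneg hx
  nlinarith [hx i, hx j, sq_nonneg (b.coord i x - b.coord j x)]

variable [FiniteDimensional ℝ E]

theorem inner_affineGradient_eq_sum [Fintype ι] (b : AffineBasis ι ℝ E) (f g : E →ᵃ[ℝ] ℝ) :
    inner ℝ (affineGradient f) (affineGradient g) = ∑ i, ∑ j, f (b i) * g (b j) *
      inner ℝ (affineGradient (b.coord i)) (affineGradient (b.coord j)) := by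
  conv_lhs => rw [← nodalInterpolant_affineMap b f, ← nodalInterpolant_affineMap b g]
  rw [nodalInterpolant, nodalInterpolant, map_sum, map_sum, sum_inner]
  simp only [inner_sum, map_smul, real_inner_smul_left, real_inner_smul_right]
  exact Finset.sum_congr rfl fun i _ => Finset.sum_congr rfl fun j _ => by ring

theorem inner_affineGradient_coord_sub_eq_one (b : AffineBasis ι ℝ E) {i j : ι} (hij : i ≠ j) :
    inner ℝ (affineGradient (b.coord i)) (b i - b j) = 1 := by
  rw [inner_affineGradient_sub, b.coord_apply_eq, b.coord_apply_ne hij, sub_zero]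

theorem inner_affineGradient_coord_sub_eq_zero (b : AffineBasis ι ℝ E) {i j k : ι} (hij : i ≠ j)
    (hik : i ≠ k) : inner ℝ (affineGradient (b.coord i)) (b j - b k) = 0 := by
  rw [inner_affineGradient_sub, b.coord_apply_ne hij, b.coord_apply_ne hik, sub_zero]

/-- A quantitative acuteness condition: the off-diagonal entries of the stiffness matrix of the
simplex `b`, per unit of volume, are at most `-B / 4`, where `1 / 4` is the maximum of the product
of two barycentric coordinates. -/
def IsAcute (B : ℝ) (b : AffineBasis ι ℝ E) : Prop :=
  Pairwise fun i j => inner ℝ (affineGradient (b.coord i)) (affineGradient (b.coord j)) ≤ -(B / 4)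

variable {b : AffineBasis ι ℝ E}

theorem IsAcute.mono {B c : ℝ} (hb : IsAcute B b) (hc : c ≤ B) : IsAcute c b := fun _ _ hij =>
  (hb hij).trans (by linarith)

theorem IsAcute.inner_add_mul_nonpos [Finite ι] {c : ℝ} (hb : IsAcute c b) (hc : 0 ≤ c)
    {f g : E →ᵃ[ℝ] ℝ} (hf : ∀ i, 0 ≤ f (b i)) (hg : ∀ i, 0 ≤ g (b i))
    (hfg : ∀ i, f (b i) * g (b i) = 0) {x : E} (hx : x ∈ convexHull ℝ (range b)) :
    inner ℝ (affineGradient f) (affineGradient g) + c * (f x * g x) ≤ 0 := by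
  cases nonempty_fintype ι
  rw [inner_affineGradient_eq_sum b, mul_eq_sum_coord_mul_coord b]
  simp only [Finset.mul_sum, ← Finset.sum_add_distrib]
  refine Finset.sum_nonpos fun i _ => Finset.sum_nonpos fun j _ => ?_
  rw [mul_left_comm, ← mul_add]
  obtain rfl | hij := eq_or_ne i j
  · rw [hfg, zero_mul]
  · have hcoord := mul_le_mul_of_nonneg_left (coord_mul_coord_le_one_div_four hij hx) hc
    exact mul_nonpos_of_nonneg_of_nonpos (mul_nonneg (hf i) (hg j)) (by linarith [hb hij])

theorem IsAcute.sq_norm_affineGradient_le [Finite ι] {c : ℝ} (hb : IsAcute c b) (hc : 0 ≤ c)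
    {f g : E →ᵃ[ℝ] ℝ} (hg : ∀ i, g (b i) = max (f (b i)) 0) {x : E}
    (hx : x ∈ convexHull ℝ (range b)) :
    ‖affineGradient g‖ ^ 2 ≤
      inner ℝ (affineGradient f) (affineGradient g) + c * (f x * g x) := by
  have hneg : inner ℝ (affineGradient (g - f)) (affineGradient g) + c * ((g - f) x * g x) ≤ 0 := by
    refine hb.inner_add_mul_nonpos hc (fun i => ?_) (fun i => ?_) (fun i => ?_) hx
    · simp [hg]
    · simp [hg]
    · rcases le_total (f (b i)) 0 with h | h <;> simp [hg, h]
  rw [map_sub, inner_sub_left, real_inner_self_eq_norm_sq, AffineMap.coe_sub, Pi.sub_apply,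
    sub_mul] at hneg
  nlinarith [mul_nonneg hc (mul_self_nonneg (g x))]

end Simplex

theorem exists_sub_eq_mul_sub {β : ℝ → ℝ} {B : NNReal} (hmono : Monotone β)
    (hlip : LipschitzWith B β) (r s : ℝ) : ∃ c ∈ Icc (0 : ℝ) B, β r - β s = c * (r - s) := by
  wlog hrs : s ≤ r generalizing r s
  · obtain ⟨c, hc, h⟩ := this s r (le_of_not_ge hrs)
    exact ⟨c, hc, by linarith⟩
  have hβ : 0 ≤ β r - β s := sub_nonneg.2 (hmono hrs)
  refine ⟨(β r - β s) / (r - s), ⟨div_nonneg hβ (sub_nonneg.2 hrs), ?_⟩, ?_⟩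
  · refine div_le_of_le_mul₀ (sub_nonneg.2 hrs) B.2 ?_
    have := hlip.dist_le_mul r s
    rwa [Real.dist_eq, Real.dist_eq, abs_of_nonneg hβ, abs_of_nonneg (sub_nonneg.2 hrs)] at this
  · obtain rfl | hne := eq_or_ne r s
    · simp
    · rw [div_mul_cancel₀ _ (sub_ne_zero.2 hne)]

section Mesh

variable {κ ι E : Type*} [NormedAddCommGroup E] [InnerProductSpace ℝ E]

/-- A conforming mesh of the open set `Ω` by the nondegenerate simplices `σ k`, given by their
vertices. The cells may stick out of `Ω`, but only along faces whose vertices lie outside `Ω`: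
this is what makes a nodal interpolant with zero values outside `Ω` vanish outside `Ω`. -/
structure IsSimplicialMesh (Ω : Set E) (σ : κ → AffineBasis ι ℝ E) : Prop where
  isOpen : IsOpen Ω
  subset_iUnion : Ω ⊆ ⋃ k, convexHull ℝ (range (σ k))
  inter_subset : ∀ k l, convexHull ℝ (range (σ k)) ∩ convexHull ℝ (range (σ l)) ⊆
    convexHull ℝ (range (σ k) ∩ range (σ l))
  diff_subset : ∀ k, convexHull ℝ (range (σ k)) \ Ω ⊆ convexHull ℝ (range (σ k) \ Ω)

/-- The closed simplices of the mesh `σ`, as subsets of the space. -/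
def cells (σ : κ → AffineBasis ι ℝ E) : Set (Set E) :=
  range fun k => convexHull ℝ (range (σ k))

variable {Ω : Set E} {σ : κ → AffineBasis ι ℝ E}

theorem vertex_mem_convexHull (b : AffineBasis ι ℝ E) (i : ι) : b i ∈ convexHull ℝ (range b) :=
  subset_convexHull ℝ _ (mem_range_self i)

theorem sub_mem_P1Space {𝒯 : Set (Set E)} {u v : E → ℝ} (hu : u ∈ P1Space Ω 𝒯)
    (hv : v ∈ P1Space Ω 𝒯) : u - v ∈ P1Space Ω 𝒯 := by
  refine ⟨hu.1.sub hv.1, fun x hx => by simp [hu.2.1 x hx, hv.2.1 x hx], fun T hT => ?_⟩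
  obtain ⟨f, hf⟩ := hu.2.2 T hT
  obtain ⟨g, hg⟩ := hv.2.2 T hT
  exact ⟨f - g, fun x hx => by simp [hf hx, hg hx]⟩

theorem exists_eqOn_of_mem_P1Space {u : E → ℝ} (hu : u ∈ P1Space Ω (cells σ)) (k : κ) :
    ∃ f : E →ᵃ[ℝ] ℝ, EqOn u f (convexHull ℝ (range (σ k))) :=
  hu.2.2 _ (mem_range_self k)

theorem IsSimplicialMesh.exists_mem (hσ : IsSimplicialMesh Ω σ) {x : E} (hx : x ∈ Ω) :
    ∃ k, x ∈ convexHull ℝ (range (σ k)) :=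
  mem_iUnion.1 (hσ.subset_iUnion hx)

theorem IsSimplicialMesh.nonneg_of_nonneg_vertices (hσ : IsSimplicialMesh Ω σ) {u : E → ℝ}
    (hu : u ∈ P1Space Ω (cells σ)) (hvert : ∀ k i, 0 ≤ u (σ k i)) (x : E) : 0 ≤ u x := by
  by_cases hx : x ∈ Ω
  · obtain ⟨k, hxk⟩ := hσ.exists_mem hx
    obtain ⟨f, hf⟩ := exists_eqOn_of_mem_P1Space hu k
    rw [hf hxk]
    refine affineMap_nonneg_on_convexHull (forall_mem_range.2 fun i => ?_) x hxk
    exact hf (vertex_mem_convexHull (σ k) i) ▸ hvert k i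
  · exact (hu.2.1 x hx).ge

theorem IsSimplicialMesh.exists_eqOn_of_compatible (hσ : IsSimplicialMesh Ω σ) {g : κ → E → ℝ}
    (hcompat : ∀ k l, EqOn (g k) (g l) (convexHull ℝ (range (σ k)) ∩ convexHull ℝ (range (σ l))))
    (hzero : ∀ k, EqOn (g k) 0 (convexHull ℝ (range (σ k)) \ Ω)) :
    ∃ v : E → ℝ, (∀ x ∉ Ω, v x = 0) ∧ ∀ k, EqOn v (g k) (convexHull ℝ (range (σ k))) := by
  classical
  choose cell hcell using fun x : Ω => hσ.exists_mem x.2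
  refine ⟨fun x => if hx : x ∈ Ω then g (cell ⟨x, hx⟩) x else 0, fun x hx => dif_neg hx,
    fun k x hxk => ?_⟩
  by_cases hx : x ∈ Ω
  · exact (dif_pos hx).trans (hcompat _ _ ⟨hcell ⟨x, hx⟩, hxk⟩)
  · exact (dif_neg hx).trans (hzero k ⟨hxk, hx⟩).symm

section Topology

variable [Finite κ] [Finite ι]

theorem isCompact_convexHull_range (b : AffineBasis ι ℝ E) : IsCompact (convexHull ℝ (range b)) :=
  (finite_range b).isCompact_convexHull ℝ

theorem IsSimplicialMesh.continuous_of_continuousOn (hσ : IsSimplicialMesh Ω σ) {v : E → ℝ}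
    (hzero : ∀ x ∉ Ω, v x = 0) (hv : ∀ k, ContinuousOn v (convexHull ℝ (range (σ k)))) :
    Continuous v := by
  let C : Option κ → Set E := fun o => o.elim Ωᶜ fun k => convexHull ℝ (range (σ k))
  refine (locallyFinite_of_finite C).continuous (eq_univ_of_forall fun x => ?_) ?_ ?_
  · by_cases hx : x ∈ Ω
    · obtain ⟨k, hxk⟩ := hσ.exists_mem hx
      exact mem_iUnion.2 ⟨some k, hxk⟩
    · exact mem_iUnion.2 ⟨none, hx⟩
  · rintro (_ | k)
    · exact hσ.isOpen.isClosed_compl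
    · exact (isCompact_convexHull_range (σ k)).isClosed
  · rintro (_ | k)
    · exact continuousOn_const.congr hzero
    · exact hv k

theorem IsSimplicialMesh.exists_mem_P1Space [FiniteDimensional ℝ E] (hσ : IsSimplicialMesh Ω σ)
    {N : E → ℝ} (hN : ∀ x ∉ Ω, N x = 0) :
    ∃ v ∈ P1Space Ω (cells σ), ∀ k i, v (σ k i) = N (σ k i) := by
  cases nonempty_fintype ι
  have hvert : ∀ k, EqOn (nodalInterpolant (σ k) N) N (range (σ k)) := fun k =>
    forall_mem_range.2 (nodalInterpolant_vertex (σ k) N)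
  have hcompat : ∀ k l, EqOn (nodalInterpolant (σ k) N) (nodalInterpolant (σ l) N)
      (convexHull ℝ (range (σ k)) ∩ convexHull ℝ (range (σ l))) := fun k l =>
    (affineMap_eqOn_convexHull fun p hp => (hvert k hp.1).trans (hvert l hp.2).symm).mono
      (hσ.inter_subset k l)
  have hzero : ∀ k, EqOn (nodalInterpolant (σ k) N) (0 : E →ᵃ[ℝ] ℝ)
      (convexHull ℝ (range (σ k)) \ Ω) := fun k =>
    (affineMap_eqOn_convexHull fun p hp => (hvert k hp.1).trans (hN p hp.2)).mono
      (hσ.diff_subset k)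
  obtain ⟨v, hv0, hv⟩ := hσ.exists_eqOn_of_compatible hcompat hzero
  refine ⟨v, ⟨?_, hv0, forall_mem_range.2 fun k => ⟨_, hv k⟩⟩, fun k i => ?_⟩
  · exact hσ.continuous_of_continuousOn hv0 fun k =>
      (AffineMap.continuous_of_finiteDimensional _).continuousOn.congr (hv k)
  · rw [hv k (vertex_mem_convexHull (σ k) i), nodalInterpolant_vertex]

theorem IsSimplicialMesh.ne_univ [Nontrivial E] (hσ : IsSimplicialMesh Ω σ) : Ω ≠ univ := by
  rintro rfl
  have : NoncompactSpace E := NormedSpace.noncompactSpace ℝ E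
  refine noncompact_univ E ?_
  rw [← univ_subset_iff.1 hσ.subset_iUnion]
  exact isCompact_iUnion fun k => isCompact_convexHull_range (σ k)

end Topology

section Measure

variable [FiniteDimensional ℝ E] [MeasureSpace E] [BorelSpace E]
  [(volume : Measure E).IsAddHaarMeasure]

theorem IsSimplicialMesh.ae_mem_interior [Countable κ] (hσ : IsSimplicialMesh Ω σ) :
    ∀ᵐ x ∂(volume.restrict Ω), ∃ k, x ∈ interior (convexHull ℝ (range (σ k))) := by
  have hfrontier : ∀ᵐ x : E, ∀ k, x ∉ frontier (convexHull ℝ (range (σ k))) :=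
    ae_all_iff.2 fun k => measure_eq_zero_iff_ae_notMem.1
      ((convex_convexHull ℝ (range (σ k))).addHaar_frontier volume)
  filter_upwards [ae_restrict_of_ae hfrontier, ae_restrict_mem hσ.isOpen.measurableSet]
    with x hx hxΩ
  obtain ⟨k, hxk⟩ := hσ.exists_mem hxΩ
  exact ⟨k, by_contra fun hint => hx k ⟨subset_closure hxk, hint⟩⟩

theorem IsSimplicialMesh.eq_vertex_of_gradient_eq_zero (hσ : IsSimplicialMesh Ω σ) {v : E → ℝ}
    (hv : v ∈ P1Space Ω (cells σ)) (hgrad : ∀ᵐ x ∂(volume.restrict Ω), gradient v x = 0) {k : κ}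
    {x : E} (hxΩ : x ∈ Ω) (hx : x ∈ convexHull ℝ (range (σ k))) (i : ι) : v x = v (σ k i) := by
  obtain ⟨f, hf⟩ := exists_eqOn_of_mem_P1Space hv k
  set T := convexHull ℝ (range (σ k))
  have hxT : x ∈ closure (interior T) := by
    rw [(convex_convexHull ℝ _).closure_interior_eq_closure_of_nonempty_interior
      (interior_convexHull_nonempty_iff_affineSpan_eq_top.2 (σ k).tot)]
    exact subset_closure hx
  have hpos : 0 < volume (Ω ∩ interior T) :=
    (hσ.isOpen.inter isOpen_interior).measure_pos volume (mem_closure_iff.1 hxT Ω hσ.isOpen hxΩ)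
  obtain ⟨y, hy, hyT⟩ : ∃ y, gradient v y = 0 ∧ y ∈ interior T := by
    rw [ae_restrict_iff' hσ.isOpen.measurableSet] at hgrad
    obtain ⟨y, hyU, hy⟩ := ((frequently_ae_mem_iff.2 hpos.ne').and_eventually hgrad).exists
    exact ⟨y, hy hyU.1, hyU.2⟩
  have hf0 : affineGradient f = 0 := by rw [← gradient_eq_affineGradient hf hyT, hy]
  rw [hf hx, hf (vertex_mem_convexHull (σ k) i)]
  exact eq_of_affineGradient_eq_zero hf0 x (σ k i)

variable [Finite κ] [Finite ι]

theorem IsSimplicialMesh.integrableOn_inner_gradient (hσ : IsSimplicialMesh Ω σ) {u v : E → ℝ}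
    (hu : u ∈ P1Space Ω (cells σ)) (hv : v ∈ P1Space Ω (cells σ)) :
    IntegrableOn (fun x => inner ℝ (gradient u x) (gradient v x)) Ω := by
  have hcell : ∀ k, IntegrableOn (fun x => inner ℝ (gradient u x) (gradient v x))
      (interior (convexHull ℝ (range (σ k)))) := fun k => by
    obtain ⟨f, hf⟩ := exists_eqOn_of_mem_P1Space hu k
    obtain ⟨g, hg⟩ := exists_eqOn_of_mem_P1Space hv k
    have hfin : volume (interior (convexHull ℝ (range (σ k)))) ≠ ⊤ :=
      ((measure_mono interior_subset).trans_lt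
        (isCompact_convexHull_range (σ k)).measure_lt_top).ne
    refine (integrableOn_const (C := inner ℝ (affineGradient f) (affineGradient g)) hfin).congr_fun
      (fun x hx => ?_) isOpen_interior.measurableSet
    simp only [gradient_eq_affineGradient hf hx, gradient_eq_affineGradient hg hx]
  refine (integrableOn_finite_iUnion.2 hcell).mono_set_ae ?_
  filter_upwards [(ae_restrict_iff' hσ.isOpen.measurableSet).1 hσ.ae_mem_interior] with x hx hxΩ
  exact mem_iUnion.2 (hx hxΩ)

theorem IsSimplicialMesh.eq_zero_of_gradient_eq_zero [Nontrivial E] (hσ : IsSimplicialMesh Ω σ)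
    {v : E → ℝ} (hv : v ∈ P1Space Ω (cells σ))
    (hgrad : ∀ᵐ x ∂(volume.restrict Ω), gradient v x = 0) (x : E) : v x = 0 := by
  -- `v` takes finitely many values, namely `0` and its values at the vertices.
  have hfin : (range v).Finite := by
    refine ((finite_range fun ki : κ × ι => v (σ ki.1 ki.2)).insert 0).subset ?_
    rintro _ ⟨y, rfl⟩
    by_cases hy : y ∈ Ω
    · obtain ⟨k, hyk⟩ := hσ.exists_mem hy
      obtain ⟨i⟩ := (σ k).nonempty
      exact Or.inr ⟨(k, i), (hσ.eq_vertex_of_gradient_eq_zero hv hgrad hy hyk i).symm⟩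
    · exact Or.inl (hv.2.1 y hy)
  have hsub : (range v).Subsingleton := not_nontrivial_iff.1 fun h =>
    (isPreconnected_range hv.1).infinite_of_nontrivial h hfin
  obtain ⟨y, hy⟩ := (ne_univ_iff_exists_notMem Ω).1 hσ.ne_univ
  rw [hsub (mem_range_self x) (mem_range_self y), hv.2.1 y hy]

theorem IsSimplicialMesh.ae_sq_norm_gradient_le (hσ : IsSimplicialMesh Ω σ) {b : E → ℝ → ℝ}
    {B : NNReal} (hb : ∀ᵐ x ∂(volume.restrict Ω), Monotone (b x) ∧ LipschitzWith B (b x))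
    (hacute : ∀ k, IsAcute B (σ k)) {u₁ u₂ v : E → ℝ} (hu₁ : u₁ ∈ P1Space Ω (cells σ))
    (hu₂ : u₂ ∈ P1Space Ω (cells σ)) (hv : v ∈ P1Space Ω (cells σ))
    (hmax : ∀ k i, v (σ k i) = max (u₁ (σ k i) - u₂ (σ k i)) 0) :
    ∀ᵐ x ∂(volume.restrict Ω), ‖gradient v x‖ ^ 2 ≤
      (inner ℝ (gradient u₁ x) (gradient v x) + b x (u₁ x) * v x) -
        (inner ℝ (gradient u₂ x) (gradient v x) + b x (u₂ x) * v x) := by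
  filter_upwards [hσ.ae_mem_interior, hb] with x ⟨k, hxint⟩ ⟨hmono, hlip⟩
  obtain ⟨f₁, hf₁⟩ := exists_eqOn_of_mem_P1Space hu₁ k
  obtain ⟨f₂, hf₂⟩ := exists_eqOn_of_mem_P1Space hu₂ k
  obtain ⟨g, hg⟩ := exists_eqOn_of_mem_P1Space hv k
  have hx := interior_subset hxint
  have hgmax : ∀ i, g (σ k i) = max ((f₁ - f₂) (σ k i)) 0 := fun i => by
    have hi := vertex_mem_convexHull (σ k) i
    rw [← hg hi, hmax, hf₁ hi, hf₂ hi, AffineMap.coe_sub, Pi.sub_apply]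
  obtain ⟨c, ⟨hc0, hcB⟩, hc⟩ := exists_sub_eq_mul_sub hmono hlip (u₁ x) (u₂ x)
  calc ‖gradient v x‖ ^ 2 = ‖affineGradient g‖ ^ 2 := by rw [gradient_eq_affineGradient hg hxint]
    _ ≤ inner ℝ (affineGradient (f₁ - f₂)) (affineGradient g) + c * ((f₁ - f₂) x * g x) :=
      ((hacute k).mono hcB).sq_norm_affineGradient_le hc0 hgmax hx
    _ = inner ℝ (gradient u₁ x - gradient u₂ x) (gradient v x) +
        (b x (u₁ x) - b x (u₂ x)) * v x := by
      rw [gradient_eq_affineGradient hf₁ hxint, gradient_eq_affineGradient hf₂ hxint,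
        gradient_eq_affineGradient hg hxint, map_sub, hc, hf₁ hx, hf₂ hx, hg hx, AffineMap.coe_sub,
        Pi.sub_apply, mul_assoc]
    _ = _ := by rw [inner_sub_left]; ring

theorem IsSimplicialMesh.le_of_isSubsolution_of_isSupersolution [Nontrivial E]
    (hσ : IsSimplicialMesh Ω σ) {b : E → ℝ → ℝ} {B : NNReal}
    (hb : ∀ᵐ x ∂(volume.restrict Ω), Monotone (b x) ∧ LipschitzWith B (b x))
    (hacute : ∀ k, IsAcute B (σ k)) {u₁ u₂ : E → ℝ} (h₁ : IsSubsolution Ω (cells σ) b u₁)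
    (h₂ : IsSupersolution Ω (cells σ) b u₂) (x : E) : u₁ x ≤ u₂ x := by
  obtain ⟨v, hv, hmax⟩ := hσ.exists_mem_P1Space (N := fun x => max (u₁ x - u₂ x) 0)
    (fun x hx => by simp [h₁.1.2.1 x hx, h₂.1.2.1 x hx])
  have hv_nonneg := hσ.nonneg_of_nonneg_vertices hv fun k i => by simp [hmax]
  obtain ⟨hint₁, hweak₁⟩ := h₁.2 v hv hv_nonneg
  obtain ⟨hint₂, hweak₂⟩ := h₂.2 v hv hv_nonneg
  have hF₁ := (hσ.integrableOn_inner_gradient h₁.1 hv).add hint₁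
  have hF₂ := (hσ.integrableOn_inner_gradient h₂.1 hv).add hint₂
  have hle := hσ.ae_sq_norm_gradient_le hb hacute h₁.1 h₂.1 hv hmax
  have hdiff_nonneg := hle.mono fun x hx => (sq_nonneg ‖gradient v x‖).trans hx
  have hdiff_integral := (integral_sub hF₁ hF₂).trans_le (sub_nonpos.2 (hweak₁.trans hweak₂))
  have hdiff_zero := (integral_eq_zero_iff_of_nonneg_ae hdiff_nonneg (hF₁.sub hF₂)).1
    (hdiff_integral.antisymm (integral_nonneg_of_ae hdiff_nonneg))
  have hgrad : ∀ᵐ x ∂(volume.restrict Ω), gradient v x = 0 := by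
    filter_upwards [hle, hdiff_zero] with x hx hx0
    exact norm_eq_zero.1 (pow_eq_zero_iff two_ne_zero |>.1
      ((hx.trans_eq hx0).antisymm (sq_nonneg _)))
  have hv_zero := hσ.eq_zero_of_gradient_eq_zero hv hgrad
  refine sub_nonneg.1 (hσ.nonneg_of_nonneg_vertices (sub_mem_P1Space h₂.1 h₁.1) (fun k i => ?_) x)
  have hpos := (hmax k i).symm.trans (hv_zero _)
  rw [max_eq_right_iff] at hpos
  exact sub_nonneg.2 (sub_nonpos.1 hpos)

end Measure

end Mesh

section Interval

/-- The interval `[r, s]` as a simplex with vertices `r` and `s`. -/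
noncomputable def segmentBasis {r s : ℝ} (hrs : r < s) : AffineBasis (Fin 2) ℝ ℝ where
  toFun := ![r, s]
  ind' := affineIndependent_of_ne ℝ hrs.ne
  tot' := (affineIndependent_of_ne ℝ hrs.ne).affineSpan_eq_top_iff_card_eq_finrank_add_one.2
    (by simp)

theorem range_segmentBasis {r s : ℝ} (hrs : r < s) : range (segmentBasis hrs) = {r, s} :=
  Matrix.range_cons_cons_empty r s _

theorem convexHull_range_segmentBasis {r s : ℝ} (hrs : r < s) :
    convexHull ℝ (range (segmentBasis hrs)) = Icc r s := by
  rw [range_segmentBasis, convexHull_pair, segment_eq_Icc hrs.le]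

theorem inner_affineGradient_coord_segmentBasis {r s : ℝ} (hrs : r < s) :
    inner ℝ (affineGradient ((segmentBasis hrs).coord 0))
      (affineGradient ((segmentBasis hrs).coord 1)) * (s - r) ^ 2 = -1 := by
  set b := segmentBasis hrs
  have h₀ : inner ℝ (affineGradient (b.coord 0)) (r - s) = 1 :=
    inner_affineGradient_coord_sub_eq_one b (i := 0) (j := 1) (by decide)
  have h₁ : inner ℝ (affineGradient (b.coord 1)) (s - r) = 1 :=
    inner_affineGradient_coord_sub_eq_one b (i := 1) (j := 0) (by decide)
  simp only [RCLike.inner_apply, conj_trivial] at h₀ h₁ ⊢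
  linear_combination -(s - r) * affineGradient (b.coord 1) * h₀ - h₁

theorem isAcute_segmentBasis {B r s : ℝ} (hrs : r < s) (hB : B * (s - r) ^ 2 ≤ 4) :
    IsAcute B (segmentBasis hrs) := by
  have hpos : 0 < (s - r) ^ 2 := pow_pos (sub_pos.2 hrs) 2
  have hinner := inner_affineGradient_coord_segmentBasis hrs
  have h₀₁ : inner ℝ (affineGradient ((segmentBasis hrs).coord 0))
      (affineGradient ((segmentBasis hrs).coord 1)) ≤ -(B / 4) := by
    refine le_of_mul_le_mul_right ?_ hpos
    linarith
  intro i j hij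
  fin_cases i <;> fin_cases j
  · exact absurd rfl hij
  · exact h₀₁
  · exact (real_inner_comm _ _).trans_le h₀₁
  · exact absurd rfl hij

variable {n : ℕ} {a : Fin (n + 1) → ℝ}

/-- The subdivision of an interval by the nodes `a`, as a mesh. -/
noncomputable def intervalMesh (ha : StrictMono a) (k : Fin n) : AffineBasis (Fin 2) ℝ ℝ :=
  segmentBasis (ha k.castSucc_lt_succ)

theorem range_intervalMesh (ha : StrictMono a) (k : Fin n) :
    range (intervalMesh ha k) = {a k.castSucc, a k.succ} :=
  range_segmentBasis _

theorem convexHull_range_intervalMesh (ha : StrictMono a) (k : Fin n) :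
    convexHull ℝ (range (intervalMesh ha k)) = Icc (a k.castSucc) (a k.succ) :=
  convexHull_range_segmentBasis _

theorem cells_intervalMesh (ha : StrictMono a) : cells (intervalMesh ha) = intervalCells a :=
  congrArg range (funext (convexHull_range_intervalMesh ha))

theorem interval_subset_iUnion_Icc (a : Fin (n + 1) → ℝ) :
    interval a ⊆ ⋃ k : Fin n, Icc (a k.castSucc) (a k.succ) := by
  intro x hx
  have hcover (k : Fin (n + 1)) (hxk : x ≤ a k) :
      x ∈ ⋃ k : Fin n, Icc (a k.castSucc) (a k.succ) := by
    induction k using Fin.induction with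
    | zero => exact absurd hx.1 hxk.not_gt
    | succ k ih => exact (le_total x (a k.castSucc)).elim ih fun h => mem_iUnion.2 ⟨k, h, hxk⟩
  exact hcover _ hx.2.le

theorem Icc_inter_Icc_subset_of_lt (ha : Monotone a) {k l : Fin n} (hkl : k < l) :
    Icc (a k.castSucc) (a k.succ) ∩ Icc (a l.castSucc) (a l.succ) ⊆
      {a k.castSucc, a k.succ} ∩ {a l.castSucc, a l.succ} := by
  rintro x ⟨hk, hl⟩
  have hle : a k.succ ≤ a l.castSucc := ha (Fin.succ_le_castSucc_iff.2 hkl)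
  exact ⟨Or.inr (hk.2.antisymm (hle.trans hl.1)), Or.inl ((hk.2.trans hle).antisymm hl.1)⟩

theorem Icc_diff_interval_subset (ha : Monotone a) (k : Fin n) :
    Icc (a k.castSucc) (a k.succ) \ interval a ⊆ {a k.castSucc, a k.succ} := by
  rintro x ⟨hxk, hx⟩
  rcases not_and_or.1 hx with h | h
  · exact Or.inl (((not_lt.1 h).trans (ha (Fin.zero_le _))).antisymm hxk.1)
  · exact Or.inr (hxk.2.antisymm ((ha (Fin.le_last _)).trans (not_lt.1 h)))

theorem isSimplicialMesh_intervalMesh (ha : StrictMono a) :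
    IsSimplicialMesh (interval a) (intervalMesh ha) where
  isOpen := isOpen_Ioo
  subset_iUnion := by
    simpa only [convexHull_range_intervalMesh] using interval_subset_iUnion_Icc a
  inter_subset k l := by
    rcases lt_trichotomy k l with hkl | rfl | hlk
    · rw [convexHull_range_intervalMesh, convexHull_range_intervalMesh, range_intervalMesh,
        range_intervalMesh]
      exact (Icc_inter_Icc_subset_of_lt ha.monotone hkl).trans (subset_convexHull ℝ _)
    · rw [inter_self, inter_self]
    · rw [inter_comm, inter_comm (range _), convexHull_range_intervalMesh,
        convexHull_range_intervalMesh, range_intervalMesh, range_intervalMesh]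
      exact (Icc_inter_Icc_subset_of_lt ha.monotone hlk).trans (subset_convexHull ℝ _)
  diff_subset k := by
    rw [convexHull_range_intervalMesh, range_intervalMesh]
    exact fun x hx => subset_convexHull ℝ _ ⟨Icc_diff_interval_subset ha.monotone k hx, hx.2⟩

end Interval

section Triangle

open EuclideanGeometry

theorem add_smul_sub_add_smul_sub_mem_convexHull {E : Type*} [AddCommGroup E] [Module ℝ E]
    (p q r : E) {c d : ℝ} (hc : 0 ≤ c) (hd : 0 ≤ d) (hcd : c + d ≤ 1) :
    r + (c • (p - r) + d • (q - r)) ∈ convexHull ℝ {p, q, r} := by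
  have hmem := (convex_convexHull ℝ {p, q, r}).sum_mem (t := Finset.univ)
    (w := ![c, d, 1 - c - d]) (z := ![p, q, r])
    (by simpa [Fin.forall_fin_succ, hc, hd, sub_sub] using hcd)
    (by simp [Fin.sum_univ_three])
    (fun i _ => subset_convexHull ℝ _ (by fin_cases i <;> simp))
  convert hmem using 1
  simp only [Fin.sum_univ_three, Matrix.cons_val]
  module

theorem parallelepiped_subset_preimage_convexHull {E : Type*} [AddCommGroup E] [Module ℝ E]
    (p q r : E) :
    parallelepiped ![p - r, q - r] ⊆ (r + ·) ⁻¹'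
      (convexHull ℝ {p, q, r} ∪ (p + q - ·) ⁻¹' convexHull ℝ {p, q, r}) := by
  -- A parallelogram is the union of one of its halves and the point reflection of that half.
  intro z hz
  obtain ⟨c, ⟨hc₀, hc₁⟩, rfl⟩ := (mem_parallelepiped_iff _ _).1 hz
  simp only [Fin.sum_univ_two, Matrix.cons_val_zero, Matrix.cons_val_one]
  rcases le_total (c 0 + c 1) 1 with h | h
  · exact Or.inl (add_smul_sub_add_smul_sub_mem_convexHull p q r (hc₀ 0) (hc₀ 1) h)
  · have hmem : r + ((1 - c 0) • (p - r) + (1 - c 1) • (q - r)) ∈ convexHull ℝ {p, q, r} :=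
      add_smul_sub_add_smul_sub_mem_convexHull p q r (sub_nonneg.2 (hc₁ 0)) (sub_nonneg.2 (hc₁ 1))
        (by linarith)
    refine Or.inr ((mem_preimage.trans (iff_of_eq (congrArg (· ∈ _) ?_))).2 hmem)
    module

variable {E : Type*} [NormedAddCommGroup E] [InnerProductSpace ℝ E]
  [Fact (Module.finrank ℝ E = 2)]

attribute [local instance] FiniteDimensional.of_fact_finrank_eq_two

theorem volume_parallelepiped_eq_ofReal_abs_areaForm [MeasurableSpace E] [BorelSpace E]
    (o : Orientation ℝ E (Fin 2)) (x y : E) :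
    volume (parallelepiped ![x, y]) = ENNReal.ofReal |o.areaForm x y| := by
  rw [o.areaForm_to_volumeForm, ← o.measure_eq_volume, AlternatingMap.measure_parallelepiped]

theorem abs_areaForm_le_two_mul_volume_convexHull [MeasurableSpace E] [BorelSpace E]
    (o : Orientation ℝ E (Fin 2)) (p q r : E) :
    |o.areaForm (p - r) (q - r)| ≤ 2 * volume.real (convexHull ℝ {p, q, r}) := by
  set T := convexHull ℝ {p, q, r}
  have hT : IsCompact T := (toFinite {p, q, r}).isCompact_convexHull ℝ
  have hreflect : volume ((p + q - ·) ⁻¹' T) = volume T :=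
    (Measure.measurePreserving_sub_left volume (p + q)).measure_preimage
      hT.measurableSet.nullMeasurableSet
  have hle : ENNReal.ofReal |o.areaForm (p - r) (q - r)| ≤ 2 * volume T :=
    calc ENNReal.ofReal |o.areaForm (p - r) (q - r)|
      _ = volume (parallelepiped ![p - r, q - r]) :=
        (volume_parallelepiped_eq_ofReal_abs_areaForm o _ _).symm
      _ ≤ volume ((r + ·) ⁻¹' (T ∪ (p + q - ·) ⁻¹' T)) :=
        measure_mono (parallelepiped_subset_preimage_convexHull p q r)
      _ = volume (T ∪ (p + q - ·) ⁻¹' T) := measure_preimage_add _ _ _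
      _ ≤ volume T + volume ((p + q - ·) ⁻¹' T) := measure_union_le _ _
      _ = 2 * volume T := by rw [hreflect, two_mul]
  have hfin : 2 * volume T ≠ ⊤ := ENNReal.mul_ne_top ENNReal.ofNat_ne_top hT.measure_lt_top.ne
  simpa [measureReal_def] using (ENNReal.ofReal_le_iff_le_toReal hfin).1 hle

theorem cot_angle_mul_abs_areaForm (o : Orientation ℝ E (Fin 2)) {x y : E}
    (h : o.areaForm x y ≠ 0) :
    Real.cot (InnerProductGeometry.angle x y) * |o.areaForm x y| = inner ℝ x y := by
  have hsin : Real.sin (InnerProductGeometry.angle x y) * (‖x‖ * ‖y‖) = |o.areaForm x y| := by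
    rw [InnerProductGeometry.sin_angle_mul_norm_mul_norm, ← Real.sqrt_sq_eq_abs,
      real_inner_self_eq_norm_sq, real_inner_self_eq_norm_sq, ← o.inner_sq_add_areaForm_sq]
    congr 1
    ring
  have hsin_ne : Real.sin (InnerProductGeometry.angle x y) ≠ 0 :=
    left_ne_zero_of_mul (hsin.trans_ne (abs_ne_zero.2 h))
  rw [Real.cot_eq_cos_div_sin, ← hsin, ← mul_assoc, div_mul_cancel₀ _ hsin_ne,
    InnerProductGeometry.cos_angle_mul_norm_mul_norm]

theorem areaForm_ne_zero_of_inner (o : Orientation ℝ E (Fin 2)) {a c y : E}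
    (hya : inner ℝ y a = 1) (hyc : inner ℝ y c = 0) (hc : c ≠ 0) : o.areaForm a c ≠ 0 := by
  intro h
  have hsq := o.inner_mul_inner_add_areaForm_mul_areaForm c y a
  rw [real_inner_comm, hyc, o.areaForm_swap c a, h, hya] at hsq
  simp [eq_comm, hc] at hsq

theorem sq_areaForm_mul_inner_dual (o : Orientation ℝ E (Fin 2)) {a c y z : E}
    (hya : inner ℝ y a = 1) (hyc : inner ℝ y c = 0) (hza : inner ℝ z a = 0)
    (hzc : inner ℝ z c = 1) :
    o.areaForm a c ^ 2 * inner ℝ y z = -inner ℝ a c := by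
  have hc : ‖c‖ ^ 2 ≠ 0 := by
    rw [← real_inner_self_eq_norm_sq, inner_self_ne_zero]
    rintro rfl
    simp at hzc
  have hay := o.inner_mul_inner_add_areaForm_mul_areaForm c a y
  have hyz := o.inner_mul_inner_add_areaForm_mul_areaForm c y z
  have haz := o.inner_mul_inner_add_areaForm_mul_areaForm c a z
  rw [real_inner_comm] at hya hyc hza hzc
  rw [hyc, hya] at hay
  rw [hyc] at hyz
  rw [hzc, hza, real_inner_comm] at haz
  refine mul_left_cancel₀ hc ?_
  rw [o.areaForm_swap]
  linear_combination -o.areaForm c a ^ 2 * hyz + o.areaForm c a * o.areaForm c z * hay +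
    ‖c‖ ^ 2 * haz

theorem abs_areaForm_mul_inner_affineGradient_coord {ι : Type*} (o : Orientation ℝ E (Fin 2))
    (b : AffineBasis ι ℝ E) {i j k : ι} (hij : i ≠ j) (hjk : j ≠ k) (hik : i ≠ k) :
    0 < |o.areaForm (b i - b j) (b k - b j)| ∧
      |o.areaForm (b i - b j) (b k - b j)| *
        inner ℝ (affineGradient (b.coord i)) (affineGradient (b.coord k)) =
      -Real.cot (∠ (b i) (b j) (b k)) := by
  have hii := inner_affineGradient_coord_sub_eq_one b hij
  have hik₀ := inner_affineGradient_coord_sub_eq_zero b hik hij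
  have hki₀ := inner_affineGradient_coord_sub_eq_zero b hik.symm hjk.symm
  have hkk := inner_affineGradient_coord_sub_eq_one b hjk.symm
  have hω := areaForm_ne_zero_of_inner o hii hik₀ (sub_ne_zero.2 (b.ind.injective.ne hjk.symm))
  refine ⟨abs_pos.2 hω, mul_left_cancel₀ (abs_ne_zero.2 hω) ?_⟩
  rw [← mul_assoc, abs_mul_abs_self, ← sq, sq_areaForm_mul_inner_dual o hii hik₀ hki₀ hkk,
    ← cot_angle_mul_abs_areaForm o hω, mul_neg, mul_comm]
  rfl

theorem isAcute_of_mul_volume_le_cot [MeasurableSpace E] [BorelSpace E] {B : ℝ} (hB : 0 ≤ B)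
    {b : AffineBasis (Fin 3) ℝ E}
    (hcot : ∀ i j k, i ≠ j → j ≠ k → i ≠ k →
      B * volume.real (convexHull ℝ (range b)) ≤ 2 * Real.cot (∠ (b i) (b j) (b k))) :
    IsAcute B b := by
  intro i k hik
  obtain ⟨j, hij, hjk⟩ : ∃ j, i ≠ j ∧ j ≠ k := by decide +revert
  let o : Orientation ℝ E (Fin 2) :=
    ((stdOrthonormalBasis ℝ E).reindex (finCongr Fact.out)).toBasis.orientation
  obtain ⟨hpos, hinner⟩ := abs_areaForm_mul_inner_affineGradient_coord o b hij hjk hik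
  have hsub : volume.real (convexHull ℝ {b i, b k, b j}) ≤
      volume.real (convexHull ℝ (range b)) :=
    measureReal_mono (convexHull_mono (by simp [insert_subset_iff]))
      (isCompact_convexHull_range b).measure_lt_top.ne
  have harea := (abs_areaForm_le_two_mul_volume_convexHull o (b i) (b k) (b j)).trans
    (mul_le_mul_of_nonneg_left hsub zero_le_two)
  refine le_of_mul_le_mul_left ?_ hpos
  rw [hinner]
  linarith [mul_le_mul_of_nonneg_left harea hB, hcot i j k hij hjk hik]

end Triangle

section Triangulation

open EuclideanGeometry EuclideanSpace

variable {K : Geometry.SimplicialComplex ℝ Plane} {Ω : Set Plane}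

theorem affineSpan_eq_top_of_mem_triangles {t : Finset Plane} (ht : t ∈ triangles K) :
    affineSpan ℝ (range ((↑) : t → Plane)) = ⊤ :=
  (K.indep ht.1).affineSpan_eq_top_iff_card_eq_finrank_add_one.2 (by simp [ht.2])

/-- The triangles of `K` as a mesh, with an arbitrary numbering of the vertices of each triangle. -/
noncomputable def triangleMesh (K : Geometry.SimplicialComplex ℝ Plane) (t : triangles K) :
    AffineBasis (Fin 3) ℝ Plane :=
  (AffineBasis.mk _ (K.indep t.2.1) (affineSpan_eq_top_of_mem_triangles t.2)).reindex
    ((t : Finset Plane).equivFinOfCardEq t.2.2)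

theorem range_triangleMesh (t : triangles K) :
    range (triangleMesh K t) = ((t : Finset Plane) : Set Plane) := by
  rw [triangleMesh, AffineBasis.coe_reindex, EquivLike.range_comp]
  exact Subtype.range_coe

theorem cells_triangleMesh (K : Geometry.SimplicialComplex ℝ Plane) :
    cells (triangleMesh K) = triangleCells K := by
  simp only [cells, range_triangleMesh, triangleCells, image_eq_range]

theorem IsTriangulation.subset_iUnion_triangles (h : IsTriangulation K Ω) :
    Ω ⊆ ⋃ t : triangles K, convexHull ℝ ((t : Finset Plane) : Set Plane) := by
  intro x hx
  obtain ⟨s, hs, hxs⟩ :=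
    Geometry.SimplicialComplex.mem_space_iff.1 (h.space_eq ▸ subset_closure hx)
  obtain ⟨t, ht, hst, hcard⟩ := h.pure s hs
  exact mem_iUnion.2 ⟨⟨t, ht, hcard⟩, convexHull_mono (Finset.coe_subset.2 hst) hxs⟩

theorem IsTriangulation.convexHull_diff_subset (h : IsTriangulation K Ω) {t : Finset Plane}
    (ht : t ∈ K.faces) :
    convexHull ℝ (t : Set Plane) \ Ω ⊆ convexHull ℝ ((t : Set Plane) \ Ω) := by
  rintro x ⟨hxt, hxΩ⟩
  obtain ⟨edges, hedges, -, hfrontier⟩ := h.frontier_eq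
  have hx : x ∈ frontier Ω := by
    rw [h.isOpen.frontier_eq, ← h.space_eq]
    exact ⟨K.convexHull_subset_space ht hxt, hxΩ⟩
  rw [hfrontier] at hx
  obtain ⟨e, he, hxe⟩ := mem_iUnion₂.1 hx
  have he_sub : (e : Set Plane) ⊆ Ωᶜ := fun p hp hpΩ => by
    have hpf : p ∈ frontier Ω :=
      hfrontier ▸ mem_iUnion₂.2 ⟨e, he, subset_convexHull ℝ _ hp⟩
    exact (h.isOpen.frontier_eq ▸ hpf).2 hpΩ
  exact convexHull_mono (inter_subset_inter_right _ he_sub)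
    (K.inter_subset_convexHull ht (hedges he) ⟨hxt, hxe⟩)

theorem IsTriangulation.isSimplicialMesh (h : IsTriangulation K Ω) :
    IsSimplicialMesh Ω (triangleMesh K) where
  isOpen := h.isOpen
  subset_iUnion := by simpa only [range_triangleMesh] using h.subset_iUnion_triangles
  inter_subset s t := by
    simpa only [range_triangleMesh] using K.inter_subset_convexHull s.2.1 t.2.1
  diff_subset t := by simpa only [range_triangleMesh] using h.convexHull_diff_subset t.2.1

theorem isAcute_triangleMesh {B : ℝ} (hB : 0 ≤ B) (t : triangles K)
    (hcot : ∀ θ ∈ interiorAngles t, B * area t ≤ 2 * Real.cot θ) :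
    IsAcute B (triangleMesh K t) := by
  have hmem (i : Fin 3) : triangleMesh K t i ∈ (t : Finset Plane) :=
    (range_triangleMesh t).subset (mem_range_self i)
  have hinj := (triangleMesh K t).ind.injective
  refine isAcute_of_mul_volume_le_cot hB fun i j k hij hjk hik => ?_
  rw [range_triangleMesh]
  exact hcot _ ⟨_, hmem i, _, hmem j, _, hmem k, hinj.ne hij, hinj.ne hjk, hinj.ne hik, rfl⟩

end Triangulation

section MeshConditions

theorem IsAdmissible.ae_monotone_lipschitzWith {E : Type*} [NormedAddCommGroup E]
    [MeasureSpace E] {Ω : Set E} {b : E → ℝ → ℝ} {B : ℝ} (hb : IsAdmissible Ω b B) :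
    ∀ᵐ x ∂(volume.restrict Ω), Monotone (b x) ∧ LipschitzWith (.mk B hb.nonneg) (b x) := by
  filter_upwards [hb.contDiff, hb.deriv_bound] with x hdiff hderiv
  have hdiff' := hdiff.differentiable one_ne_zero
  refine ⟨monotone_of_deriv_nonneg hdiff' fun η => (hderiv η).1,
    lipschitzWith_of_nnnorm_deriv_le hdiff' fun η => ?_⟩
  exact (Real.norm_of_nonneg (hderiv η).1).trans_le (hderiv η).2

theorem mul_le_four_of_lt_two_div {B x : ℝ} (hB : 0 ≤ B) (h : 0 < B → x < 2 / B) : B * x ≤ 4 := by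
  rcases hB.eq_or_lt with rfl | hB
  · simp
  · linarith [(lt_div_iff₀' hB).1 (h hB)]

theorem cot_pos_of_mem_Ioo {θ : ℝ} (hθ : θ ∈ Ioo 0 (Real.pi / 2)) : 0 < Real.cot θ := by
  rw [Real.cot_eq_cos_div_sin]
  exact div_pos (Real.cos_pos_of_mem_Ioo ⟨by linarith [hθ.1, hθ.2], hθ.2⟩)
    (Real.sin_pos_of_pos_of_lt_pi hθ.1 (by linarith [hθ.1, hθ.2]))

theorem IsRegularMesh.mul_area_le {K : Geometry.SimplicialComplex ℝ Plane} {tmin tmax B : ℝ}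
    (hK : IsRegularMesh K tmin tmax) (hB : 0 ≤ B) {t : Finset Plane} (ht : t ∈ triangles K) {θ : ℝ}
    (hθ : θ ∈ interiorAngles t) (h : 0 < B → area t < 3 / (7 * B) * Real.cot θ) :
    B * area t ≤ 2 * Real.cot θ := by
  have hθ' := hK.angles t ht θ hθ
  have hcot := cot_pos_of_mem_Ioo ⟨hK.pos.trans_le hθ'.1, hθ'.2.trans_lt hK.lt⟩
  rcases hB.eq_or_lt with rfl | hB
  · linarith
  · have := mul_lt_mul_of_pos_left (h hB) hB
    have hsimp : B * (3 / (7 * B) * Real.cot θ) = 3 / 7 * Real.cot θ := by field_simp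
    linarith

end MeshConditions

end SemilinearFEM

open SemilinearFEM in
theorem theorem5p1_general :
    (∀ (n : ℕ) (a : Fin (n + 1) → ℝ) (b : ℝ → ℝ → ℝ) (B : NNReal) (u₁ u₂ : ℝ → ℝ),
      StrictMono a →
      (∀ᵐ x ∂(volume.restrict (interval a)), Monotone (b x) ∧ LipschitzWith B (b x)) →
      IsSubsolution (interval a) (intervalCells a) b u₁ →
      IsSupersolution (interval a) (intervalCells a) b u₂ →
      (∀ k : Fin n, B * (a k.succ - a k.castSucc) ^ 2 ≤ 4) →
      ∀ x, u₁ x ≤ u₂ x) ∧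
    (∀ (Ω : Set Plane) (K : Geometry.SimplicialComplex ℝ Plane) (b : Plane → ℝ → ℝ) (B : NNReal)
      (u₁ u₂ : Plane → ℝ),
      IsTriangulation K Ω →
      (∀ᵐ x ∂(volume.restrict Ω), Monotone (b x) ∧ LipschitzWith B (b x)) →
      IsSubsolution Ω (triangleCells K) b u₁ →
      IsSupersolution Ω (triangleCells K) b u₂ →
      (∀ t ∈ triangles K, ∀ θ ∈ interiorAngles t, B * area t ≤ 2 * Real.cot θ) →
      ∀ x, u₁ x ≤ u₂ x) := by
  refine ⟨fun n a b B u₁ u₂ ha hb h₁ h₂ hmesh => ?_,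
    fun Ω K b B u₁ u₂ hK hb h₁ h₂ hmesh => ?_⟩
  · rw [← cells_intervalMesh ha] at h₁ h₂
    exact (isSimplicialMesh_intervalMesh ha).le_of_isSubsolution_of_isSupersolution hb
      (fun k => isAcute_segmentBasis _ (hmesh k)) h₁ h₂
  · rw [← cells_triangleMesh] at h₁ h₂
    have : Finite (triangles K) := (hK.finite.subset fun _ ht => ht.1).to_subtype
    exact hK.isSimplicialMesh.le_of_isSubsolution_of_isSupersolution hb
      (fun t => isAcute_triangleMesh B.2 t (hmesh t t.2)) h₁ h₂

theorem theorem5p1 :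
    -- one space dimension
    (∀ (n : ℕ) (a : Fin (n + 1) → ℝ) (b : ℝ → ℝ → ℝ) (B : ℝ) (u₁ u₂ : ℝ → ℝ),
      1 ≤ n →
      StrictMono a →
      SemilinearFEM.IsAdmissible (SemilinearFEM.interval a) b B →
      SemilinearFEM.IsSubsolution (SemilinearFEM.interval a) (SemilinearFEM.intervalCells a) b u₁ →
      SemilinearFEM.IsSupersolution (SemilinearFEM.interval a) (SemilinearFEM.intervalCells a)
        b u₂ →
      -- the mesh condition is void if `B = 0`, where the bound is `+∞`
      (0 < B → ∀ k : Fin n, (a k.succ - a k.castSucc) ^ 2 < 2 / B) →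
      ∀ x ∈ SemilinearFEM.interval a, u₁ x ≤ u₂ x) ∧
    -- two space dimensions
    (∀ (Ω : Set SemilinearFEM.Plane) (K : Geometry.SimplicialComplex ℝ SemilinearFEM.Plane)
      (tmin tmax : ℝ) (b : SemilinearFEM.Plane → ℝ → ℝ) (B : ℝ)
      (u₁ u₂ : SemilinearFEM.Plane → ℝ),
      SemilinearFEM.IsTriangulation K Ω →
      SemilinearFEM.IsRegularMesh K tmin tmax →
      SemilinearFEM.IsAdmissible Ω b B →
      SemilinearFEM.IsSubsolution Ω (SemilinearFEM.triangleCells K) b u₁ →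
      SemilinearFEM.IsSupersolution Ω (SemilinearFEM.triangleCells K) b u₂ →
      (0 < B → ∀ t ∈ SemilinearFEM.triangles K, ∀ θ ∈ SemilinearFEM.interiorAngles t,
        SemilinearFEM.area t < 3 / (7 * B) * Real.cot θ) →
      ∀ x ∈ Ω, u₁ x ≤ u₂ x) := by
  exact ⟨fun n a b B u₁ u₂ _ ha hb h₁ h₂ hmesh x _ =>
      theorem5p1_general.1 n a b (.mk B hb.nonneg) u₁ u₂ ha hb.ae_monotone_lipschitzWith h₁ h₂
        (fun k => SemilinearFEM.mul_le_four_of_lt_two_div hb.nonneg fun hB => hmesh hB k) x,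
    fun Ω K tmin tmax b B u₁ u₂ hK hreg hb h₁ h₂ hmesh x _ =>
      theorem5p1_general.2 Ω K b (.mk B hb.nonneg) u₁ u₂ hK hb.ae_monotone_lipschitzWith h₁ h₂
        (fun t ht θ hθ => hreg.mul_area_le hb.nonneg ht hθ fun hB => hmesh hB t ht θ hθ) x⟩
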